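/- **Models.** All logarithms are base $2$. Let $f:\mathcal X\times\mathcal Y\to\{0,1\}$, where Alice holds $x\in\mathcal X$ and Bob holds $y\in\mathcal Y$. In a private-coin one-way protocol Alice draws a uniformly random string and sends Bob a binary message depending on $x$ and her coins; Bob outputs a bit depending on $y$ and the message. The protocol solves $f$ if it errs with probability at most $1/3$ on every input; its cost is the maximum length of Alice's message; $R^{\to}(f)$ is the minimum cost of such a protocol solving $f$. In an online Merlin–Arthur (OMA) protocol Merlin, who knows $x$ and $y$, first sends Bob a help message $\mathcal H(x,y)$; then a random string $\mathcal R$ is drawn; Alice sends Bob a message depending on $x$ and $\mathcal R$ only; Bob outputs a value in $\{0,1,\bot\}$ depending on $y$, the help message, Alice's message and $\mathcal R$. The protocol solves $f$ if, whenever $f(x,y)=1$, the output with help message $\mathcal H(x,y)$ is $1$ with probability at least $2/3$, and, whenever $f(x,y)=0$, for every help message the output is $1$ with probability at most $1/3$. Its $\mathsf{hcost}$ and $\mathsf{vcost}$ are the maximum lengths of Merlin's message $\mathcal H(x,y)$ and of Alice's message, and $\mathsf{tcost}=\mathsf{hcost}+\mathsf{vcost}$. $\mathrm{MA}^{\to}(f)$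 is the minimum $\mathsf{tcost}$ of an OMA protocol solving $f$. For a family $(f_N)$, a family of OMA protocols $(\Pi_N)$ solving $(f_N)$ is non-trivial if $\mathsf{vcost}(\Pi_N)=o(R^{\to}(f_N))$, and the non-trivial OMA complexity $\widehat{\mathrm{MA}}^{\to}(f_N)$ is the minimum $\mathsf{tcost}$ over non-trivial protocols; thus $\widehat{\mathrm{MA}}^{\to}(f_N)=\omega(g(N))$ means that non-trivial families exist and that each of them has $\mathsf{tcost}(\Pi_N)=\omega(g(N))$. **Statement.** In the sparse index problem $\textsc{sp-idx}_{m,N}$ Alice holds $x\in\{0,1\}^N$, promised to have at most $m$ ones, Bob holds $j\in[N]$, and Bob has to output $x[j]$. For $m=\log\log N$ (rounded up or down to an integer), as $N\to\infty$, $$\widehat{\mathrm{MA}}^{\to}(\textsc{sp-idx}_{m,N})=\omega(\log N),$$ whereas $$R^{\to}(\textsc{sp-idx}_{m,N})=\Theta(\log\log N)\quad\text{and}\quad \mathrm{MA}^{\to}(\textsc{sp-idx}_{m,N})=\Theta(\log\log N).$$ The same holds if the promise is that $x$ has exactly $m$ ones. -/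

import Mathlib

open Filter Asymptotics

/-- The probability of an event `E` over a uniformly random string of `r` bits. -/
noncomputable def coinProb (r : ℕ) (E : (Fin r → Bool) → Prop) : ℝ :=
  (Nat.card {ρ : Fin r → Bool // E ρ} : ℝ) / 2 ^ r

/-- A private-coin one-way protocol: Alice, on input `x`, draws a random string `ρ` and sends the
binary string `msg x ρ`; Bob, who does not see `ρ`, outputs a bit. -/
structure OneWayProtocol (X Y : Type) where
  coins : ℕ
  msg : X → (Fin coins → Bool) → List Bool
  out : Y → List Bool → Bool

namespace OneWayProtocol

variable {X Y : Type}

/-- The protocol computes `f` with error at most `1/3` on every input. -/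
def Solves (P : OneWayProtocol X Y) (f : X → Y → Bool) : Prop :=
  ∀ x y, coinProb P.coins (fun ρ => P.out y (P.msg x ρ) ≠ f x y) ≤ 1 / 3

/-- The maximum length of Alice's message over all her inputs and coin tosses. -/
def cost [Fintype X] (P : OneWayProtocol X Y) : ℕ :=
  Finset.univ.sup fun p : X × (Fin P.coins → Bool) => (P.msg p.1 p.2).length

end OneWayProtocol

/-- The one-way (private-coin) randomized communication complexity of `f`. -/
noncomputable def oneWayComplexity {X Y : Type} [Fintype X] (f : X → Y → Bool) : ℕ :=
  sInf {c | ∃ P : OneWayProtocol X Y, P.Solves f ∧ P.cost = c}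

/-- An online Merlin-Arthur protocol: (honest) Merlin, who knows both inputs, sends Bob the help
message `help x y`; then the random string `ρ` is drawn, and Alice, who does not see the help
message, sends Bob `msg x ρ`; then Bob, who also knows `ρ`, outputs `0`, `1`
or `⊥` (which is `none`). -/
structure OMAProtocol (X Y : Type) where
  coins : ℕ
  help : X → Y → List Bool
  msg : X → (Fin coins → Bool) → List Bool
  out : Y → List Bool → List Bool → (Fin coins → Bool) → Option Bool

namespace OMAProtocol

variable {X Y : Type}

/-- Completeness error and soundness error, the latter against arbitrary help messages, are at
most `1/3`. -/
def Solves (P : OMAProtocol X Y) (f : X → Y → Bool) : Prop :=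
  (∀ x y, f x y = true →
    coinProb P.coins (fun ρ => P.out y (P.help x y) (P.msg x ρ) ρ ≠ some true) ≤ 1 / 3) ∧
  (∀ x y, f x y = false → ∀ h' : List Bool,
    coinProb P.coins (fun ρ => P.out y h' (P.msg x ρ) ρ = some true) ≤ 1 / 3)

/-- The help cost: the maximum length of Merlin's message. -/
def hcost [Fintype X] [Fintype Y] (P : OMAProtocol X Y) : ℕ :=
  Finset.univ.sup fun p : X × Y => (P.help p.1 p.2).length

/-- The verification cost: the maximum length of Alice's message. -/
def vcost [Fintype X] (P : OMAProtocol X Y) : ℕ :=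
  Finset.univ.sup fun p : X × (Fin P.coins → Bool) => (P.msg p.1 p.2).length

/-- The total cost. -/
def tcost [Fintype X] [Fintype Y] (P : OMAProtocol X Y) : ℕ :=
  P.hcost + P.vcost

end OMAProtocol

/-- The online Merlin-Arthur complexity of `f`. -/
noncomputable def omaComplexity {X Y : Type} [Fintype X] [Fintype Y] (f : X → Y → Bool) : ℕ :=
  sInf {c | ∃ P : OMAProtocol X Y, P.Solves f ∧ P.tcost = c}

/-- A sequence of online Merlin-Arthur protocols for a sequence of functions `f N` is non-trivial
if they solve these functions with verification cost `o(R(f N))`, where `R` is the one-way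
randomized complexity. -/
def IsNonTrivialOMA {X Y : ℕ → Type} [∀ N, Fintype (X N)]
    (f : ∀ N, X N → Y N → Bool) (P : ∀ N, OMAProtocol (X N) (Y N)) : Prop :=
  (∀ N, (P N).Solves (f N)) ∧
  (fun N => ((P N).vcost : ℝ)) =o[atTop] (fun N => (oneWayComplexity (f N) : ℝ))

/-- "The non-trivial online Merlin-Arthur complexity of the functions `f N`, i.e. the minimum total
cost of a non-trivial protocol, is `ω(g N)`": non-trivial protocols exist, and all of them have
total cost `ω(g N)`. -/
def NonTrivialOMAComplexityLittleOmega {X Y : ℕ → Type} [∀ N, Fintype (X N)] [∀ N, Fintype (Y N)]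
    (f : ∀ N, X N → Y N → Bool) (g : ℕ → ℝ) : Prop :=
  (∃ P : ∀ N, OMAProtocol (X N) (Y N), IsNonTrivialOMA f P) ∧
  ∀ P : ∀ N, OMAProtocol (X N) (Y N), IsNonTrivialOMA f P →
    g =o[atTop] (fun N => ((P N).tcost : ℝ))

/-- The number of ones of a bit string. -/
def onesCount {N : ℕ} (x : Fin N → Bool) : ℕ :=
  (Finset.univ.filter fun i => x i = true).card

/-- The bit strings of length `N` whose number of ones lies in `W`. -/
abbrev StringsOfWeight (W : Set ℕ) (N : ℕ) : Type :=
  {x : Fin N → Bool // onesCount x ∈ W}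

noncomputable instance (W : Set ℕ) (N : ℕ) : Fintype (StringsOfWeight W N) :=
  Fintype.ofFinite _

/-- The Index problem with the promise that the number of ones of Alice's string lies in `W`:
Bob wants to know the bit of Alice's string at his position. With `W = {w | w ≤ m}`, or
`W = {m}`, this is the sparse index problem with sparsity `m`. -/
def spIdx (W : Set ℕ) (N : ℕ) (x : StringsOfWeight W N) (j : Fin N) : Bool :=
  x.1 j

/-! Everything rests on the trade-off `m * log N = O((vcost + 1) * (hcost + log N))` of
`OMAProtocol.Solves.mul_logb_le`. Amplify an OMA protocol by `O(hcost + log N)` repetitions, so that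
a union bound covers every position of Bob and every short help message. For some fixed coins,
Alice's repeated messages then determine `x` for half of all inputs: Bob's bit is 1 iff some help
message wins a majority. Compare with the at least `(N / m) ^ m` inputs. With `m` about `log log N`,
the trade-off forces `vcost = Ω(log log N)` or `hcost ≥ log N`, hence `MA = Ω(log log N)`, and so
also `R = Ω(log log N)`. If `vcost = o(log log N)`, it forces `hcost = ω(log N)`. Hashing Alice's
ones into `O(m)` buckets (`exists_oneWayProtocol_spIdx`) gives the upper bounds, and a two-bit
fingerprint (`fingerprintProtocol_solves`) shows that non-trivial protocols exist. -/

/-! ### Tail bounds and amplification. -/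

/-- Markov's inequality for `2 ^ k`, where `k` is the number of coordinates of a uniformly random
tuple that satisfy `E`. -/
theorem card_many_successes {ι Ω : Type*} [Fintype ι] [DecidableEq ι] [Fintype Ω]
    (E : Ω → Prop) [DecidablePred E] (l : ℕ) :
    (Finset.univ.filter fun w : ι → Ω =>
        l ≤ (Finset.univ.filter fun i => E (w i)).card).card * 2 ^ l ≤
      (Fintype.card Ω + (Finset.univ.filter E).card) ^ Fintype.card ι := by
  calc _ = ∑ w ∈ Finset.univ.filter fun w : ι → Ω =>
        l ≤ (Finset.univ.filter fun i => E (w i)).card, 2 ^ l := by simp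
    _ ≤ ∑ w ∈ Finset.univ.filter fun w : ι → Ω =>
        l ≤ (Finset.univ.filter fun i => E (w i)).card,
          2 ^ (Finset.univ.filter fun i => E (w i)).card := by
        refine Finset.sum_le_sum fun w hw => ?_
        exact Nat.pow_le_pow_right (by norm_num) (Finset.mem_filter.1 hw).2
    _ ≤ ∑ w : ι → Ω, 2 ^ (Finset.univ.filter fun i => E (w i)).card :=
        Finset.sum_le_sum_of_subset (Finset.filter_subset _ _)
    _ = ∑ w : ι → Ω, ∏ i, (if E (w i) then 2 else 1) := by
        refine Finset.sum_congr rfl fun w _ => ?_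
        rw [Finset.prod_ite]; simp
    _ = ∏ _i : ι, ∑ ω : Ω, (if E ω then 2 else 1) := by
        rw [Finset.prod_univ_sum, Fintype.piFinset_univ]
    _ = _ := by
        rw [Finset.prod_const, Finset.card_univ]
        congr 1
        have : ∀ ω : Ω, (if E ω then 2 else 1) = 1 + (if E ω then 1 else 0) := by
          intro ω; split_ifs <;> rfl
        simp_rw [this]
        rw [Finset.sum_add_distrib]
        simp

/-- The binary strings of length at most `c`. -/
def shortStrings (c : ℕ) : Finset (List Bool) :=
  (Finset.range (c + 1)).biUnion fun k => Finset.univ.image (List.ofFn : (Fin k → Bool) → _)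

theorem mem_shortStrings {c : ℕ} {s : List Bool} : s ∈ shortStrings c ↔ s.length ≤ c := by
  simp only [shortStrings, Finset.mem_biUnion, Finset.mem_range, Finset.mem_image,
    Finset.mem_univ, true_and]
  constructor
  · rintro ⟨k, hk, g, rfl⟩
    simp; omega
  · intro h
    exact ⟨s.length, by omega, s.get, List.ofFn_get s⟩

theorem card_shortStrings_le (c : ℕ) : (shortStrings c).card ≤ 2 ^ (c + 1) := by
  refine Finset.card_biUnion_le.trans ?_
  calc _ ≤ ∑ k ∈ Finset.range (c + 1), 2 ^ k := by
        refine Finset.sum_le_sum fun k _ => Finset.card_image_le.trans ?_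
        simp
    _ ≤ 2 ^ (c + 1) := (Nat.geomSum_lt le_rfl (by simp)).le

theorem coinProb_le_third_iff {r : ℕ} {E : (Fin r → Bool) → Prop} [DecidablePred E] :
    coinProb r E ≤ 1 / 3 ↔
      3 * (Finset.univ.filter E).card ≤ Fintype.card (Fin r → Bool) := by
  have h2 : (0 : ℝ) < 2 ^ r := by positivity
  rw [coinProb, div_le_div_iff₀ h2 (by norm_num), Nat.card_eq_fintype_card,
    Fintype.card_subtype]
  simp only [Fintype.card_fun, Fintype.card_bool, Fintype.card_fin]
  rw [one_mul, mul_comm]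
  exact_mod_cast Iff.rfl

/-- The majority of `12 * q` independent trials of error at most `1 / 3` errs with probability
at most `2 ^ (-q)`. -/
theorem card_majority_error_le {Ω : Type*} [Fintype Ω] (E : Ω → Prop) [DecidablePred E]
    (hE : 3 * (Finset.univ.filter E).card ≤ Fintype.card Ω) (q : ℕ) :
    2 ^ q * (Finset.univ.filter fun w : Fin (12 * q) → Ω =>
        6 * q ≤ (Finset.univ.filter fun i => E (w i)).card).card ≤
      Fintype.card (Fin (12 * q) → Ω) := by
  have h := card_many_successes (ι := Fin (12 * q)) E (6 * q)
  set b := (Finset.univ.filter fun w : Fin (12 * q) → Ω =>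
        6 * q ≤ (Finset.univ.filter fun i => E (w i)).card).card
  rw [Fintype.card_fin] at h
  rw [Fintype.card_fun, Fintype.card_fin]
  have h1 : 3 ^ (12 * q) * (b * 2 ^ (6 * q)) ≤ 4 ^ (12 * q) * Fintype.card Ω ^ (12 * q) := by
    calc _ ≤ 3 ^ (12 * q) * _ := Nat.mul_le_mul_left _ h
      _ = (3 * (Fintype.card Ω + (Finset.univ.filter E).card)) ^ (12 * q) := by rw [mul_pow]
      _ ≤ (4 * Fintype.card Ω) ^ (12 * q) := Nat.pow_le_pow_left (by omega) _
      _ = _ := by rw [mul_pow]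
  -- This amounts to `2 ^ 19 ≤ 3 ^ 12`, which barely holds and accounts for the 12.
  have h2 : 2 ^ q * 4 ^ (12 * q) ≤ 3 ^ (12 * q) * 2 ^ (6 * q) := by
    rw [pow_mul 4, pow_mul 3, pow_mul 2, ← mul_pow, ← mul_pow]
    exact Nat.pow_le_pow_left (by norm_num) _
  have h3 : 4 ^ (12 * q) * (2 ^ q * b) ≤ 4 ^ (12 * q) * Fintype.card Ω ^ (12 * q) := by
    calc _ = (2 ^ q * 4 ^ (12 * q)) * b := by ring
      _ ≤ (3 ^ (12 * q) * 2 ^ (6 * q)) * b := Nat.mul_le_mul_right _ h2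
      _ = 3 ^ (12 * q) * (b * 2 ^ (6 * q)) := by ring
      _ ≤ _ := h1
  exact Nat.le_of_mul_le_mul_left h3 (by positivity)

/-! ### Lower bound: Alice's messages encode her input. -/

theorem OMAProtocol.length_msg_le {X Y : Type} [Fintype X] (P : OMAProtocol X Y) (x : X)
    (ρ : Fin P.coins → Bool) : (P.msg x ρ).length ≤ P.vcost :=
  Finset.le_sup (f := fun p : X × (Fin P.coins → Bool) => (P.msg p.1 p.2).length)
    (Finset.mem_univ (x, ρ))

theorem OMAProtocol.length_help_le {X Y : Type} [Fintype X] [Fintype Y] (P : OMAProtocol X Y)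
    (x : X) (y : Y) : (P.help x y).length ≤ P.hcost :=
  Finset.le_sup (f := fun p : X × Y => (P.help p.1 p.2).length) (Finset.mem_univ (x, y))

open Classical in
/-- If the rows of `f` are pairwise distinct, then an online Merlin-Arthur protocol for `f` lets
Alice describe her input with `O (vcost * (hcost + log |Y|))` bits. -/
theorem OMAProtocol.Solves.card_le {X Y : Type} [Fintype X] [Fintype Y] {f : X → Y → Bool}
    (hf : Function.Injective f) {P : OMAProtocol X Y} (hP : P.Solves f) {n : ℕ}
    (hn : Fintype.card Y ≤ 2 ^ n) :
    Fintype.card X ≤ 2 * 2 ^ ((P.vcost + 1) * (12 * (P.hcost + n + 2))) := by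
  set q := P.hcost + n + 2 with hq
  let Ω := Fin P.coins → Bool
  let A : X → Y → List Bool → Ω → Prop := fun x y h ρ => P.out y h (P.msg x ρ) ρ = some true
  -- The error event: on a 1-input only the honest help matters, whatever `h` is; on a 0-input every
  -- `h` is a possible cheat.
  let E : X → Y → List Bool → Ω → Prop := fun x y h ρ =>
    if f x y = true then ¬ A x y (P.help x y) ρ else A x y h ρ
  have hE : ∀ x y h, 3 * (Finset.univ.filter (E x y h)).card ≤ Fintype.card Ω := by
    intro x y h
    rw [← coinProb_le_third_iff]
    by_cases hxy : f x y = true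
    · simpa [E, A, hxy] using hP.1 x y hxy
    · simpa [E, A, hxy] using hP.2 x y (by simpa using hxy) h
  let B : X → Y → List Bool → Finset (Fin (12 * q) → Ω) := fun x y h =>
    Finset.univ.filter fun w => 6 * q ≤ (Finset.univ.filter fun i => E x y h (w i)).card
  have hB : ∀ x y h, 2 ^ q * (B x y h).card ≤ Fintype.card (Fin (12 * q) → Ω) :=
    fun x y h => card_majority_error_le (E x y h) (hE x y h) q
  let D : X → Finset (Fin (12 * q) → Ω) := fun x =>
    (Finset.univ ×ˢ shortStrings P.hcost).biUnion fun p => B x p.1 p.2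
  have hD : ∀ x, 2 * (D x).card ≤ Fintype.card (Fin (12 * q) → Ω) := by
    intro x
    have h1 : 2 ^ q * (D x).card ≤
        (Fintype.card Y * (shortStrings P.hcost).card) * Fintype.card (Fin (12 * q) → Ω) := by
      calc _ ≤ 2 ^ q * ∑ p ∈ Finset.univ ×ˢ shortStrings P.hcost, (B x p.1 p.2).card :=
            Nat.mul_le_mul_left _ Finset.card_biUnion_le
        _ = ∑ p ∈ Finset.univ ×ˢ shortStrings P.hcost, 2 ^ q * (B x p.1 p.2).card :=
            Finset.mul_sum _ _ _
        _ ≤ ∑ p ∈ (Finset.univ : Finset Y) ×ˢ shortStrings P.hcost,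
              Fintype.card (Fin (12 * q) → Ω) :=
            Finset.sum_le_sum fun p _ => hB x p.1 p.2
        _ = _ := by
            rw [Finset.sum_const, Finset.card_product, Finset.card_univ, smul_eq_mul]
    have h2 : Fintype.card Y * (shortStrings P.hcost).card ≤ 2 ^ n * 2 ^ (P.hcost + 1) :=
      Nat.mul_le_mul hn (card_shortStrings_le _)
    -- The choice of `q` makes the union bound over `Y` and the short help messages exactly one
    -- half.
    have h3 : 2 ^ q = (2 ^ n * 2 ^ (P.hcost + 1)) * 2 := by rw [hq]; ring
    have h4 := h1.trans (Nat.mul_le_mul_right _ h2)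
    rw [h3, mul_assoc] at h4
    exact Nat.le_of_mul_le_mul_left h4 (by positivity)
  -- Averaging over `w` fixes coins that are good for at least half of the inputs.
  obtain ⟨w, hw⟩ : ∃ w : Fin (12 * q) → Ω,
      2 * (Finset.univ.filter fun x => w ∈ D x).card ≤ Fintype.card X := by
    have hs : ∑ w : Fin (12 * q) → Ω, 2 * (Finset.univ.filter fun x => w ∈ D x).card ≤
        ∑ _w : Fin (12 * q) → Ω, Fintype.card X := by
      rw [← Finset.mul_sum]
      simp_rw [Finset.card_filter]
      rw [Finset.sum_comm, Finset.mul_sum]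
      simp only [Finset.sum_ite_mem, Finset.univ_inter, Finset.sum_const, smul_eq_mul, mul_one]
      refine (Finset.sum_le_sum fun x _ => hD x).trans ?_
      simp [mul_comm]
    obtain ⟨w, -, hw⟩ := Finset.exists_le_of_sum_le Finset.univ_nonempty hs
    exact ⟨w, hw⟩
  -- The right-hand side depends on `x` only through the messages `P.msg x (w i)`; this makes the
  -- encoding below injective.
  have hdec : ∀ x, w ∉ D x → ∀ y, f x y = true ↔ ∃ h ∈ shortStrings P.hcost,
      6 * q ≤ (Finset.univ.filter fun i => A x y h (w i)).card := by
    intro x hx y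
    have hx' : ∀ h ∈ shortStrings P.hcost,
        (Finset.univ.filter fun i => E x y h (w i)).card < 6 * q := by
      intro h hh
      by_contra hcon
      exact hx (Finset.mem_biUnion.2 ⟨(y, h), by simp [hh], by simpa [B] using hcon⟩)
    constructor
    · intro hxy
      have hh : P.help x y ∈ shortStrings P.hcost := mem_shortStrings.2 (P.length_help_le x y)
      refine ⟨_, hh, ?_⟩
      have h1 := hx' _ hh
      simp only [E, hxy, if_true] at h1
      have h2 := Finset.card_filter_add_card_filter_not (s := Finset.univ)
        (fun i => A x y (P.help x y) (w i))
      rw [Finset.card_univ, Fintype.card_fin] at h2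
      omega
    · rintro ⟨h, hh, hc⟩
      by_contra hxy
      have h1 := hx' _ hh
      simp only [E, hxy] at h1
      exact absurd hc (not_le.2 h1)
  have hgood : (Finset.univ.filter fun x => w ∉ D x).card ≤
      (Fintype.piFinset fun _ : Fin (12 * q) => shortStrings P.vcost).card := by
    refine Finset.card_le_card_of_injOn (fun x i => P.msg x (w i)) ?_ ?_
    · intro x _
      simp only [Finset.mem_coe, Fintype.mem_piFinset]
      exact fun i => mem_shortStrings.2 (P.length_msg_le x _)
    · intro x hx x' hx' hxx
      have hx := (Finset.mem_filter.1 hx).2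
      have hx' := (Finset.mem_filter.1 hx').2
      apply hf
      funext y
      have hm : ∀ i, P.msg x (w i) = P.msg x' (w i) := fun i => congrFun hxx i
      rw [Bool.eq_iff_iff, hdec x hx y, hdec x' hx' y]
      simp only [A, hm]
  rw [Fintype.card_piFinset_const] at hgood
  have h2 := Finset.card_filter_add_card_filter_not (s := Finset.univ) (fun x => w ∈ D x)
  rw [Finset.card_univ] at h2
  have h3 := Nat.pow_le_pow_left (card_shortStrings_le P.vcost) (12 * q)
  rw [← pow_mul] at h3
  omega

/-! ### Upper bound: hashing with few private coins. -/

/-- Overwriting `h i` by an arbitrary value loses nothing, as `h i` can be recovered from `h j`. -/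
theorem card_mul_card_collision_le {α β : Type*} [Fintype α] [DecidableEq α] [Fintype β]
    [DecidableEq β] {i j : α} (hij : i ≠ j) :
    Fintype.card β * (Finset.univ.filter fun h : α → β => h i = h j).card ≤
      Fintype.card (α → β) := by
  rw [← Fintype.card_subtype, ← Fintype.card_prod]
  refine Fintype.card_le_of_injective
    (fun p : β × {h : α → β // h i = h j} => Function.update p.2.1 i p.1) ?_
  rintro ⟨b, h, hh⟩ ⟨b', h', hh'⟩ heq
  simp only at heq
  have hk : ∀ k, k ≠ i → h k = h' k := by
    intro k hk
    simpa [Function.update_of_ne hk] using congrFun heq k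
  have hb : b = b' := by simpa using congrFun heq i
  have : h = h' := by
    funext k
    by_cases hki : k = i
    · rw [hki, hh, hh']; exact hk j (Ne.symm hij)
    · exact hk k hki
  subst hb this
  rfl

theorem one_add_inv_pow_le_three {B : ℕ} (hB : 0 < B) : (1 + 1 / (B : ℝ)) ^ B ≤ 3 := by
  have hB' : (0 : ℝ) < B := by exact_mod_cast hB
  calc (1 + 1 / (B : ℝ)) ^ B ≤ (Real.exp (1 / B)) ^ B := by
        gcongr
        rw [add_comm]
        exact Real.add_one_le_exp _
    _ = Real.exp 1 := by
        rw [← Real.exp_nat_mul]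
        congr 1
        field_simp
    _ ≤ 3 := Real.exp_one_lt_three.le

/-- There are `B * u` hash functions into `B` buckets, with `u = O (log N)`, such that any two
points collide under at most `2 * u` of them. -/
theorem exists_hash_family {ι : Type*} [Fintype ι] {B u n N : ℕ} (hB : 0 < B) (hn : 0 < n)
    (hN : N ≤ 2 ^ n) (hu : 6 * n ≤ u) (hι : Fintype.card ι = B * u) :
    ∃ H : ι → Fin N → Fin B, ∀ i j, i ≠ j →
      (Finset.univ.filter fun ρ => H ρ i = H ρ j).card ≤ 2 * u := by
  classical
  by_contra! hcon
  set Ω := Fin N → Fin B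
  have hB' : (0 : ℝ) < B := by exact_mod_cast hB
  -- For a random family, `2 ^ (number of collisions)` has mean at most `(1 + 1 / B) ^ (B * u) ≤ 3 ^
  -- u`, against the threshold `2 ^ (2 * u) = 4 ^ u`.
  have hpair : ∀ i j : Fin N, i ≠ j →
      (((Finset.univ.filter fun H : ι → Ω =>
        2 * u ≤ (Finset.univ.filter fun ρ => H ρ i = H ρ j).card).card : ℕ) : ℝ) * 4 ^ u ≤
          (Fintype.card Ω : ℝ) ^ (B * u) * 3 ^ u := by
    intro i j hij
    have h := card_many_successes (ι := ι) (fun h : Ω => h i = h j) (2 * u)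
    have hc := card_mul_card_collision_le (β := Fin B) hij
    rw [Fintype.card_fin] at hc
    rw [hι, pow_mul] at h
    norm_num only at h
    have h' : (((Finset.univ.filter fun H : ι → Ω =>
        2 * u ≤ (Finset.univ.filter fun ρ => H ρ i = H ρ j).card).card : ℕ) : ℝ) * 4 ^ u ≤
        ((Fintype.card Ω : ℝ) + (Finset.univ.filter fun h : Ω => h i = h j).card) ^ (B * u) := by
      exact_mod_cast h
    refine h'.trans ?_
    have hc' : ((Finset.univ.filter fun h : Ω => h i = h j).card : ℝ) ≤
        (Fintype.card Ω : ℝ) * (1 / B) := by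
      rw [mul_one_div, le_div_iff₀ hB', mul_comm]
      exact_mod_cast hc
    calc _ ≤ ((Fintype.card Ω : ℝ) * (1 + 1 / B)) ^ (B * u) := by
          gcongr
          linarith
      _ = (Fintype.card Ω : ℝ) ^ (B * u) * ((1 + 1 / (B : ℝ)) ^ B) ^ u := by
          rw [mul_pow, pow_mul (1 + 1 / (B : ℝ))]
      _ ≤ _ := by
          gcongr
          exact one_add_inv_pow_le_three hB
  have hcover : (Finset.univ : Finset (ι → Ω)) ⊆
      (Finset.univ.filter fun p : Fin N × Fin N => p.1 ≠ p.2).biUnion fun p =>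
        Finset.univ.filter fun H : ι → Ω =>
          2 * u ≤ (Finset.univ.filter fun ρ => H ρ p.1 = H ρ p.2).card := by
    intro H _
    obtain ⟨i, j, hij, h⟩ := hcon H
    exact Finset.mem_biUnion.2 ⟨(i, j), by simp [hij], by simpa using h.le⟩
  have htot := (Finset.card_le_card hcover).trans Finset.card_biUnion_le
  rw [Finset.card_univ, Fintype.card_fun, hι] at htot
  have hΩ : (0 : ℝ) < (Fintype.card Ω : ℝ) ^ (B * u) := by
    have : Nonempty Ω := ⟨fun _ => ⟨0, hB⟩⟩
    have := Fintype.card_pos (α := Ω)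
    positivity
  have hsum : (Fintype.card Ω : ℝ) ^ (B * u) * 4 ^ u ≤
      (Fintype.card Ω : ℝ) ^ (B * u) * ((N : ℝ) ^ 2 * 3 ^ u) := by
    have htot' : (Fintype.card Ω : ℝ) ^ (B * u) ≤
        ∑ p ∈ Finset.univ.filter fun p : Fin N × Fin N => p.1 ≠ p.2,
          (((Finset.univ.filter fun H : ι → Ω =>
          2 * u ≤ (Finset.univ.filter fun ρ => H ρ p.1 = H ρ p.2).card).card : ℕ) : ℝ) := by
      exact_mod_cast htot
    calc _ ≤ _ := mul_le_mul_of_nonneg_right htot' (by positivity)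
      _ ≤ ∑ p ∈ Finset.univ.filter fun p : Fin N × Fin N => p.1 ≠ p.2,
          (Fintype.card Ω : ℝ) ^ (B * u) * 3 ^ u := by
          rw [Finset.sum_mul]
          exact Finset.sum_le_sum fun p hp => hpair p.1 p.2 (Finset.mem_filter.1 hp).2
      _ ≤ ∑ p : Fin N × Fin N, (Fintype.card Ω : ℝ) ^ (B * u) * 3 ^ u :=
          Finset.sum_le_sum_of_subset_of_nonneg (Finset.filter_subset _ _)
            fun _ _ _ => by positivity
      _ = _ := by
          simp only [Finset.sum_const, Finset.card_univ, Fintype.card_prod, Fintype.card_fin,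
            nsmul_eq_mul, Nat.cast_mul]
          ring
  have hfin := le_of_mul_le_mul_left hsum hΩ
  obtain ⟨d, rfl⟩ := Nat.exists_eq_add_of_le hu
  have hN' : (N : ℝ) ^ 2 ≤ 4 ^ n := by
    calc (N : ℝ) ^ 2 ≤ (2 ^ n) ^ 2 := by gcongr; exact_mod_cast hN
      _ = 4 ^ n := by rw [← pow_mul, mul_comm, pow_mul]; norm_num
  -- The union bound over `N ^ 2 ≤ 4 ^ n` pairs succeeds because `4 * 3 ^ 6 < 4 ^ 6`.
  have h1 : (4 : ℝ) ^ n * 3 ^ (6 * n + d) < 4 ^ (6 * n + d) := by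
    rw [pow_add, pow_add, pow_mul, pow_mul, ← mul_assoc, ← mul_pow]
    apply mul_lt_mul
    · exact pow_lt_pow_left₀ (by norm_num) (by norm_num) hn.ne'
    · gcongr; norm_num
    · positivity
    · positivity
  have h2 : (N : ℝ) ^ 2 * 3 ^ (6 * n + d) ≤ 4 ^ n * 3 ^ (6 * n + d) := by gcongr
  linarith

/-- Alice draws a hash function from the family `H` and sends its name and the set of buckets that
are hit by the ones of her string. -/
def hashProtocol (W : Set ℕ) (N : ℕ) {t B : ℕ} (H : (Fin t → Bool) → Fin N → Fin B) :
    OneWayProtocol (StringsOfWeight W N) (Fin N) where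
  coins := t
  msg x ρ := List.ofFn ρ ++ List.ofFn fun b => decide (∃ i, x.1 i = true ∧ H ρ i = b)
  -- The first `t` bits name the hash function and bit `t + b` describes bucket `b`; the defaults
  -- are never reached on Alice's messages.
  out j s := s.getD (t + H (fun k => s.getD k false) j) false

theorem hashProtocol_cost_le (W : Set ℕ) (N : ℕ) {t B : ℕ}
    (H : (Fin t → Bool) → Fin N → Fin B) : (hashProtocol W N H).cost ≤ t + B :=
  Finset.sup_le fun p _ => by simp [hashProtocol]

theorem hashProtocol_out (W : Set ℕ) (N : ℕ) {t B : ℕ} (H : (Fin t → Bool) → Fin N → Fin B)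
    (x : StringsOfWeight W N) (j : Fin N) (ρ : Fin t → Bool) :
    (hashProtocol W N H).out j ((hashProtocol W N H).msg x ρ) =
      decide (∃ i, x.1 i = true ∧ H ρ i = H ρ j) := by
  have h1 : ∀ k : Fin t, (List.ofFn ρ ++ List.ofFn fun b =>
      decide (∃ i, x.1 i = true ∧ H ρ i = b)).getD k false = ρ k := by
    intro k
    rw [List.getD_append _ _ _ _ (by simp)]
    simp [List.getD_eq_getElem?_getD]
  simp only [hashProtocol, h1]
  rw [List.getD_append_right _ _ _ _ (by simp)]
  simp [List.getD_eq_getElem?_getD]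

/-- The error is one-sided: a one at `j` always hits its own bucket, and otherwise each of the at
most `m` ones collides with `j` under at most `c` hash functions. -/
theorem hashProtocol_solves {W : Set ℕ} {N t B m : ℕ} (hW : ∀ w ∈ W, w ≤ m)
    (H : (Fin t → Bool) → Fin N → Fin B) {c : ℕ}
    (hH : ∀ i j, i ≠ j → (Finset.univ.filter fun ρ => H ρ i = H ρ j).card ≤ c)
    (hc : 3 * (m * c) ≤ 2 ^ t) :
    (hashProtocol W N H).Solves (spIdx W N) := by
  intro x j
  change coinProb t (fun ρ : Fin t → Bool =>
    (hashProtocol W N H).out j ((hashProtocol W N H).msg x ρ) ≠ spIdx W N x j) ≤ 1 / 3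
  simp only [hashProtocol_out, spIdx]
  by_cases hx : x.1 j = true
  · have : ∀ ρ, ∃ i, x.1 i = true ∧ H ρ i = H ρ j := fun ρ => ⟨j, hx, rfl⟩
    simp [this, hx, coinProb]
  · rw [coinProb_le_third_iff]
    refine le_trans (Nat.mul_le_mul_left 3 ?_) (hc.trans_eq (by simp))
    calc _ ≤ ((Finset.univ.filter fun i => x.1 i = true).biUnion fun i =>
          Finset.univ.filter fun ρ => H ρ i = H ρ j).card := by
          refine Finset.card_le_card fun ρ hρ => ?_
          have hρ := (Finset.mem_filter.1 hρ).2
          simp only [hx, ne_eq, decide_eq_false_iff_not, not_not] at hρ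
          simpa using hρ
      _ ≤ ∑ i ∈ Finset.univ.filter fun i => x.1 i = true, c :=
          Finset.card_biUnion_le.trans <| Finset.sum_le_sum fun i hi => hH i j <| by
            rintro rfl
            exact hx (Finset.mem_filter.1 hi).2
      _ = onesCount x.1 * c := by simp [onesCount]
      _ ≤ m * c := Nat.mul_le_mul_right _ (hW _ x.2)

theorem exists_pow_two_between {k : ℕ} (hk : 0 < k) : ∃ a, k ≤ 2 ^ a ∧ 2 ^ a ≤ 2 * k := by
  refine ⟨Nat.log 2 k + 1, (Nat.lt_pow_succ_log_self one_lt_two k).le, ?_⟩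
  have := Nat.pow_log_le_self 2 hk.ne'
  rw [pow_succ]; omega

/-- Sparse index has a one-way protocol of cost `O (m + log log N)`. -/
theorem exists_oneWayProtocol_spIdx {W : Set ℕ} {N m n w : ℕ} (hW : ∀ k ∈ W, k ≤ m) (hm : 0 < m)
    (hn : 0 < n) (hN : N ≤ 2 ^ n) (hw : 6 * n ≤ 2 ^ w) :
    ∃ P : OneWayProtocol (StringsOfWeight W N) (Fin N),
      P.Solves (spIdx W N) ∧ P.cost ≤ 18 * m + w + 3 := by
  -- With `2 ^ (a + 3) ≥ 8 * m` buckets the error is at most `2 / 8`. Powers of two let the coin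
  -- string itself name the hash function.
  obtain ⟨a, ha, ha'⟩ := exists_pow_two_between hm
  have hlt : a < 2 ^ a := Nat.lt_two_pow_self
  obtain ⟨H, hH⟩ := exists_hash_family (ι := Fin (a + 3 + w) → Bool) (B := 2 ^ (a + 3))
    (by positivity) hn hN hw (by simp [pow_add])
  refine ⟨hashProtocol W N H, hashProtocol_solves hW H hH ?_, ?_⟩
  · calc 3 * (m * (2 * 2 ^ w)) ≤ 3 * (2 ^ a * (2 * 2 ^ w)) := by gcongr
      _ = 6 * (2 ^ a * 2 ^ w) := by ring
      _ ≤ 8 * (2 ^ a * 2 ^ w) := by gcongr; norm_num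
      _ = 2 ^ (a + 3 + w) := by ring
  · refine (hashProtocol_cost_le W N H).trans ?_
    rw [pow_add]; omega

/-! ### Comparing the one-way and OMA complexities. -/

/-- Bob may ignore Merlin. -/
def OneWayProtocol.toOMA {X Y : Type} (P : OneWayProtocol X Y) : OMAProtocol X Y where
  coins := P.coins
  help _ _ := []
  msg := P.msg
  out y _ s _ := some (P.out y s)

theorem OneWayProtocol.Solves.toOMA {X Y : Type} {P : OneWayProtocol X Y} {f : X → Y → Bool}
    (hP : P.Solves f) : P.toOMA.Solves f := by
  constructor
  · intro x y hxy
    simpa [OneWayProtocol.toOMA, hxy] using hP x y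
  · intro x y hxy _
    simpa [OneWayProtocol.toOMA, hxy] using hP x y

theorem OneWayProtocol.tcost_toOMA {X Y : Type} [Fintype X] [Fintype Y]
    (P : OneWayProtocol X Y) : P.toOMA.tcost = P.cost := by
  have : P.toOMA.hcost = 0 := Nat.le_zero.1 (Finset.sup_le fun _ _ => by
    simp [OneWayProtocol.toOMA])
  rw [OMAProtocol.tcost, this, zero_add]
  rfl

theorem OneWayProtocol.Solves.complexity_le {X Y : Type} [Fintype X] {f : X → Y → Bool}
    {P : OneWayProtocol X Y} (hP : P.Solves f) : oneWayComplexity f ≤ P.cost :=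
  Nat.sInf_le ⟨P, hP, rfl⟩

/-- The protocol `P` guarantees that the infimum defining `oneWayComplexity` is attained; over the
empty set it would be 0. -/
theorem OneWayProtocol.Solves.oma_le {X Y : Type} [Fintype X] [Fintype Y] {f : X → Y → Bool}
    {P : OneWayProtocol X Y} (hP : P.Solves f) : omaComplexity f ≤ oneWayComplexity f := by
  obtain ⟨Q, hQ, hQc⟩ := Nat.sInf_mem
    (s := {c | ∃ P : OneWayProtocol X Y, P.Solves f ∧ P.cost = c}) ⟨_, P, hP, rfl⟩
  refine Nat.sInf_le ⟨Q.toOMA, hQ.toOMA, ?_⟩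
  rw [OneWayProtocol.tcost_toOMA, hQc, oneWayComplexity]

theorem OneWayProtocol.Solves.exists_oma {X Y : Type} [Fintype X] [Fintype Y]
    {f : X → Y → Bool} {P : OneWayProtocol X Y} (hP : P.Solves f) :
    ∃ Q : OMAProtocol X Y, Q.Solves f ∧ Q.tcost = omaComplexity f :=
  Nat.sInf_mem (s := {c | ∃ Q : OMAProtocol X Y, Q.Solves f ∧ Q.tcost = c})
    ⟨_, P.toOMA, hP.toOMA, rfl⟩

/-! ### A protocol with verification cost two. -/

/-- Flipping the bit at position `k`. -/
def flipBit {ι : Type*} [DecidableEq ι] (k : ι) (ρ : ι → Bool) : ι → Bool :=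
  Function.update ρ k (!ρ k)

theorem flipBit_injective {ι : Type*} [DecidableEq ι] (k : ι) :
    Function.Injective (flipBit k) := by
  have : Function.Involutive (flipBit k) := by
    intro ρ
    simp [flipBit]
  exact this.injective

/-- Two uniformly random pairs of bits are equal with probability at most `1 / 3`. -/
theorem three_mul_card_agree_le {ι : Type*} [Fintype ι] [DecidableEq ι] {a a' b b' : ι}
    (ha : a ≠ a') (hb : b ≠ b') (hba' : b ≠ a') (hb'a' : b' ≠ a') (hab' : a ≠ b') :
    3 * (Finset.univ.filter fun ρ : ι → Bool => ρ a = ρ a' ∧ ρ b = ρ b').card ≤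
      Fintype.card (ι → Bool) := by
  set M := Finset.univ.filter fun ρ : ι → Bool => ρ a = ρ a' ∧ ρ b = ρ b' with hM
  have hM' : ∀ ρ ∈ M, ρ a = ρ a' ∧ ρ b = ρ b' := fun ρ hρ => (Finset.mem_filter.1 hρ).2
  -- Flipping `a'` or `b'` breaks exactly one of the two equalities, which gives three disjoint sets
  -- of equal size.
  have h1 : ∀ ρ ∈ M.image (flipBit a'), ρ a ≠ ρ a' ∧ ρ b = ρ b' := by
    intro ρ hρ
    obtain ⟨σ, hσ, rfl⟩ := Finset.mem_image.1 hρ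
    have := hM' σ hσ
    simp [flipBit, Function.update_of_ne, ha, hba', hb'a', this.1, this.2]
  have h2 : ∀ ρ ∈ M.image (flipBit b'), ρ a = ρ a' ∧ ρ b ≠ ρ b' := by
    intro ρ hρ
    obtain ⟨σ, hσ, rfl⟩ := Finset.mem_image.1 hρ
    have := hM' σ hσ
    simp [flipBit, Function.update_of_ne, hb, hb'a'.symm, hab', this.1, this.2]
  have d1 : Disjoint M (M.image (flipBit a')) :=
    Finset.disjoint_left.2 fun ρ h h' => (h1 ρ h').1 (hM' ρ h).1
  have d2 : Disjoint (M ∪ M.image (flipBit a')) (M.image (flipBit b')) := by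
    refine Finset.disjoint_left.2 fun ρ h h' => ?_
    rcases Finset.mem_union.1 h with h | h
    · exact (h2 ρ h').2 (hM' ρ h).2
    · exact (h1 ρ h).1 (h2 ρ h').1
  have hc := Finset.card_le_univ ((M ∪ M.image (flipBit a')) ∪ M.image (flipBit b'))
  rw [Finset.card_union_of_disjoint d2, Finset.card_union_of_disjoint d1,
    Finset.card_image_of_injective _ (flipBit_injective _),
    Finset.card_image_of_injective _ (flipBit_injective _)] at hc
  omega

/-- The two-bit fingerprint of `x` read from public coins. -/
noncomputable def fingerprint {X : Type} [Fintype X] (x : X)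
    (ρ : Fin (Fintype.card X + Fintype.card X) → Bool) : List Bool :=
  [ρ (Fin.castAdd _ (Fintype.equivFin X x)), ρ (Fin.natAdd _ (Fintype.equivFin X x))]

open Classical in
/-- Merlin sends an encoding of Alice's input, which Bob verifies with a fingerprint. -/
noncomputable def fingerprintProtocol {X Y : Type} [Fintype X] (f : X → Y → Bool)
    (enc : X → List Bool) : OMAProtocol X Y where
  coins := Fintype.card X + Fintype.card X
  help x _ := enc x
  msg := fingerprint
  out y h s ρ := some (decide (∃ x, enc x = h ∧ f x y = true ∧ fingerprint x ρ = s))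

/-- A cheating help message must encode some `x' ≠ x`, and it is fixed before the coins; the
fingerprints of `x` and `x'` then agree with probability at most 1/3. -/
theorem fingerprintProtocol_solves {X Y : Type} [Fintype X] (f : X → Y → Bool)
    {enc : X → List Bool} (henc : Function.Injective enc) :
    (fingerprintProtocol f enc).Solves f := by
  classical
  constructor
  · intro x y hxy
    have : ∀ ρ, ∃ x', enc x' = enc x ∧ f x' y = true ∧ fingerprint x' ρ = fingerprint x ρ :=
      fun ρ => ⟨x, rfl, hxy, rfl⟩
    simp [fingerprintProtocol, this, coinProb]
  · intro x y hxy h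
    by_cases hx : ∃ x', enc x' = h ∧ f x' y = true
    · obtain ⟨x', rfl, hx'⟩ := hx
      have hne : x' ≠ x := by
        rintro rfl
        simp [hx'] at hxy
      have he : (Fintype.equivFin X x' : ℕ) ≠ Fintype.equivFin X x := fun h =>
        hne ((Fintype.equivFin X).injective (Fin.ext h))
      have h1 := (Fintype.equivFin X x').2
      have h2 := (Fintype.equivFin X x).2
      rw [coinProb_le_third_iff]
      refine le_trans (Nat.mul_le_mul_left 3 (Finset.card_le_card ?_))
        (three_mul_card_agree_le (a := Fin.castAdd _ (Fintype.equivFin X x'))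
          (a' := Fin.castAdd _ (Fintype.equivFin X x))
          (b := Fin.natAdd _ (Fintype.equivFin X x'))
          (b' := Fin.natAdd _ (Fintype.equivFin X x)) ?_ ?_ ?_ ?_ ?_)
      · intro ρ hρ
        have hρ := (Finset.mem_filter.1 hρ).2
        simp only [fingerprintProtocol, Option.some.injEq, decide_eq_true_eq] at hρ
        obtain ⟨x'', hx'', -, hs⟩ := hρ
        rw [henc hx''] at hs
        exact Finset.mem_filter.2 ⟨Finset.mem_univ _, by simpa [fingerprint] using hs⟩
      all_goals
        simp only [ne_eq, Fin.ext_iff, Fin.val_castAdd, Fin.val_natAdd]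
        omega
    · have : ∀ s ρ, ¬ ∃ x', enc x' = h ∧ f x' y = true ∧ fingerprint x' ρ = s :=
        fun s ρ ⟨x', h1, h2, _⟩ => hx ⟨x', h1, h2⟩
      simp [fingerprintProtocol, this, coinProb]

theorem fingerprintProtocol_vcost_le {X Y : Type} [Fintype X] (f : X → Y → Bool)
    (enc : X → List Bool) : (fingerprintProtocol f enc).vcost ≤ 2 :=
  Finset.sup_le fun p _ => by simp [fingerprintProtocol, fingerprint]

/-! ### Counting sparse strings, and the trade-off. -/

theorem spIdx_injective (W : Set ℕ) (N : ℕ) : Function.Injective (spIdx W N) :=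
  fun _ _ h => Subtype.ext h

theorem choose_le_card_stringsOfWeight {W : Set ℕ} {N m : ℕ} (hm : m ∈ W) :
    N.choose m ≤ Fintype.card (StringsOfWeight W N) := by
  classical
  have hc : ∀ s : Finset (Fin N), onesCount (fun i => decide (i ∈ s)) = s.card := by
    intro s; simp [onesCount]
  rw [← Fintype.card_fin N, ← Fintype.card_finset_len (α := Fin N) m, Fintype.card_fin]
  refine Fintype.card_le_of_injective
    (fun s => ⟨fun i => decide (i ∈ s.1), by rw [hc, s.2]; exact hm⟩) ?_
  intro s s' h
  apply Subtype.ext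
  ext i
  simpa using congrFun (congrArg Subtype.val h) i

theorem pow_le_choose_mul_pow {N m : ℕ} (h : m ≤ N) : N ^ m ≤ N.choose m * m ^ m := by
  induction m generalizing N with
  | zero => simp
  | succ m ih =>
    obtain ⟨N, rfl⟩ : ∃ M, N = M + 1 := ⟨N - 1, by omega⟩
    have hr := Nat.add_one_mul_choose_eq N m
    have h1 := ih (N := N) (by omega)
    -- This is `(N + 1) / (m + 1) ≤ N / m`, valid for `m ≤ N`, with denominators cleared.
    have h2 : ((N + 1) * m) ^ m ≤ (N * (m + 1)) ^ m := Nat.pow_le_pow_left (by nlinarith) _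
    rcases Nat.eq_zero_or_pos m with rfl | hm
    · simp
    have h3 : (N + 1) ^ (m + 1) * m ^ m ≤ (N + 1).choose (m + 1) * (m + 1) ^ (m + 1) * m ^ m := by
      calc _ = (N + 1) * ((N + 1) * m) ^ m := by rw [mul_pow]; ring
        _ ≤ (N + 1) * (N * (m + 1)) ^ m := Nat.mul_le_mul_left _ h2
        _ = (N + 1) * (m + 1) ^ m * N ^ m := by rw [mul_pow]; ring
        _ ≤ (N + 1) * (m + 1) ^ m * (N.choose m * m ^ m) := Nat.mul_le_mul_left _ h1
        _ = ((N + 1) * N.choose m) * (m + 1) ^ m * m ^ m := by ring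
        _ = _ := by rw [hr]; ring
    exact Nat.le_of_mul_le_mul_right h3 (by positivity)

theorem tendsto_logb_two_natCast : Tendsto (fun N : ℕ => Real.logb 2 (N : ℝ)) atTop atTop :=
  (Real.tendsto_logb_atTop one_lt_two).comp tendsto_natCast_atTop_atTop

theorem tendsto_logb_two_logb_two_natCast :
    Tendsto (fun N : ℕ => Real.logb 2 (Real.logb 2 (N : ℝ))) atTop atTop :=
  (Real.tendsto_logb_atTop one_lt_two).comp tendsto_logb_two_natCast

theorem eventually_logb_two_add_one_sq_le :
    ∀ᶠ x : ℝ in atTop, (Real.logb 2 x + 1) ^ 2 ≤ x := by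
  have h2 : (0 : ℝ) < Real.log 2 := Real.log_pos one_lt_two
  -- This constant yields `4 * (logb 2 x) ^ 2 ≤ x`, and `logb 2 x + 1 ≤ 2 * logb 2 x` once `logb 2 x
  -- ≥ 1`.
  have hc : (0 : ℝ) < (Real.log 2 / 2) ^ 2 := by positivity
  filter_upwards [(Real.isLittleO_pow_log_id_atTop (n := 2)).bound hc,
    (Real.tendsto_logb_atTop one_lt_two).eventually_ge_atTop 1, eventually_ge_atTop 0]
    with x hx h1 h0
  rw [id, Real.norm_of_nonneg (sq_nonneg _), Real.norm_of_nonneg h0] at hx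
  have h3 : (Real.logb 2 x) ^ 2 * 4 ≤ x := by
    rw [Real.logb, div_pow]
    rw [div_pow] at hx
    have : Real.log x ^ 2 / Real.log 2 ^ 2 ≤ x / 2 ^ 2 := by
      rw [div_le_iff₀ (by positivity)]
      calc _ ≤ _ := hx
        _ = _ := by ring
    linarith
  nlinarith

theorem clog_two_le_logb_add_one {N : ℕ} (hN : 1 < N) :
    (Nat.clog 2 N : ℝ) ≤ Real.logb 2 N + 1 := by
  have h := Nat.pow_pred_clog_lt_self one_lt_two hN
  have h0 : (0 : ℝ) < N := by positivity
  have hp := Nat.clog_pos one_lt_two hN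
  have h1 : ((Nat.clog 2 N - 1 : ℕ) : ℝ) ≤ Real.logb 2 N := by
    rw [Real.le_logb_iff_rpow_le one_lt_two h0, Real.rpow_natCast]
    exact_mod_cast h.le
  rw [Nat.cast_sub hp] at h1
  push_cast at h1
  linarith

/-- The trade-off between the help cost and the verification cost of sparse index. -/
theorem OMAProtocol.Solves.mul_logb_le {W : Set ℕ} {N m : ℕ}
    {P : OMAProtocol (StringsOfWeight W N) (Fin N)} (hP : P.Solves (spIdx W N)) (hm : m ∈ W)
    (hN : 3 ≤ Real.logb 2 N) (hmN : m ^ 2 ≤ N) :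
    m * Real.logb 2 N ≤ 50 * ((P.vcost + 1) * (P.hcost + Real.logb 2 N)) := by
  have hN1 : 1 < N := by
    by_contra hcon
    have : N = 0 ∨ N = 1 := by omega
    rcases this with rfl | rfl <;> norm_num at hN
  have hN0 : (0 : ℝ) < N := by positivity
  have hle : m ≤ N := (Nat.le_self_pow two_ne_zero m).trans hmN
  have hcard := (choose_le_card_stringsOfWeight (N := N) hm).trans
    (hP.card_le (spIdx_injective W N) (n := Nat.clog 2 N)
      (by simpa using Nat.le_pow_clog one_lt_two N))
  set K := (P.vcost + 1) * (12 * (P.hcost + Nat.clog 2 N + 2)) with hK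
  -- Since `m ^ 2 ≤ N`, the number of inputs is at least `(N / m) ^ m ≥ N ^ (m / 2)`.
  have h1 : N ^ m * N ^ m ≤ (2 ^ (1 + K)) ^ 2 * N ^ m := by
    calc N ^ m * N ^ m ≤ (N.choose m * m ^ m) * (N.choose m * m ^ m) :=
          Nat.mul_le_mul (pow_le_choose_mul_pow hle) (pow_le_choose_mul_pow hle)
      _ = (N.choose m) ^ 2 * (m ^ 2) ^ m := by rw [← pow_mul, mul_comm 2 m, pow_mul]; ring
      _ ≤ (2 ^ (1 + K)) ^ 2 * N ^ m := by
          rw [pow_add, pow_one]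
          gcongr
  have h2 : N ^ m ≤ 2 ^ (2 * (1 + K)) := by
    rw [mul_comm 2, pow_mul]
    exact Nat.le_of_mul_le_mul_right h1 (by positivity)
  have h3 : m * Real.logb 2 N ≤ 2 * (1 + K) := by
    rw [← Real.logb_pow, Real.logb_le_iff_le_rpow one_lt_two (by positivity)]
    have : ((N : ℝ)) ^ m ≤ 2 ^ (2 * (1 + K)) := by exact_mod_cast h2
    refine this.trans_eq ?_
    rw [← Real.rpow_natCast]
    push_cast
    rfl
  have hcl := clog_two_le_logb_add_one hN1
  have hv : (1 : ℝ) ≤ (P.vcost : ℝ) + 1 := by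
    have : (0 : ℝ) ≤ P.vcost := Nat.cast_nonneg _
    linarith
  have hh : (0 : ℝ) ≤ P.hcost := Nat.cast_nonneg _
  have h4 : (K : ℝ) ≤ (P.vcost + 1) * (24 * (P.hcost + Real.logb 2 N)) := by
    rw [hK]
    push_cast
    refine mul_le_mul_of_nonneg_left ?_ (by linarith)
    linarith
  have h5 : (1 : ℝ) ≤ (P.vcost + 1) * (P.hcost + Real.logb 2 N) := by nlinarith
  linarith

theorem exists_oneWayProtocol_spIdx_cost_le {W : Set ℕ} {N m : ℕ} (hW : ∀ k ∈ W, k ≤ m)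
    (hm : |(m : ℝ) - Real.logb 2 (Real.logb 2 N)| < 1) (hN : 10 ≤ Real.logb 2 (Real.logb 2 N))
    (hN' : 1 ≤ Real.logb 2 N) :
    ∃ P : OneWayProtocol (StringsOfWeight W N) (Fin N),
      P.Solves (spIdx W N) ∧ (P.cost : ℝ) ≤ 30 * Real.logb 2 (Real.logb 2 N) := by
  have hN1 : 1 < N := by
    by_contra hcon
    have : N = 0 ∨ N = 1 := by omega
    rcases this with rfl | rfl <;> norm_num at hN'
  have hn := Nat.clog_pos one_lt_two hN1
  rw [abs_lt] at hm
  have hm0 : 0 < m := by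
    have : (0 : ℝ) < m := by linarith
    exact_mod_cast this
  obtain ⟨w, hw, hw'⟩ := exists_pow_two_between (k := 6 * Nat.clog 2 N) (by omega)
  obtain ⟨P, hP, hc⟩ := exists_oneWayProtocol_spIdx hW hm0 hn (Nat.le_pow_clog one_lt_two N) hw
  refine ⟨P, hP, ?_⟩
  have hcl := clog_two_le_logb_add_one hN1
  -- `2 ^ w ≤ 12 * clog N ≤ 24 * log N ≤ 2 ^ 5 * log N`.
  have hw2 : (w : ℝ) ≤ 5 + Real.logb 2 (Real.logb 2 N) := by
    have h5 : (5 : ℝ) = Real.logb 2 (2 ^ (5 : ℕ)) := by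
      rw [Real.logb_pow, Real.logb_self_eq_one one_lt_two]; norm_num
    rw [h5, ← Real.logb_mul (by norm_num) (by positivity),
      Real.le_logb_iff_rpow_le one_lt_two (by positivity), Real.rpow_natCast]
    have : (2 : ℝ) ^ w ≤ 2 * (6 * Nat.clog 2 N) := by exact_mod_cast hw'
    linarith
  have hc' : (P.cost : ℝ) ≤ 18 * m + w + 3 := by exact_mod_cast hc
  linarith

/-! ### The asymptotic statement. -/

/-- Sparse index with sparsity `m = log log N` (rounded up or down to an integer), where the
promise on the number of ones of Alice's string is either "at most `m`" or "exactly `m`". -/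
theorem corollary4 (m : ℕ → ℕ)
    (hm : ∀ᶠ N : ℕ in atTop, |(m N : ℝ) - Real.logb 2 (Real.logb 2 (N : ℝ))| < 1)
    (W : ℕ → Set ℕ)
    (hW : (∀ N, W N = {w | w ≤ m N}) ∨ (∀ N, W N = {m N})) :
    NonTrivialOMAComplexityLittleOmega (fun N => spIdx (W N) N)
        (fun N => Real.logb 2 (N : ℝ)) ∧
      (fun N : ℕ => (oneWayComplexity (spIdx (W N) N) : ℝ)) =Θ[atTop]
        (fun N => Real.logb 2 (Real.logb 2 (N : ℝ))) ∧
      (fun N : ℕ => (omaComplexity (spIdx (W N) N) : ℝ)) =Θ[atTop]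
        (fun N => Real.logb 2 (Real.logb 2 (N : ℝ))) := by
  -- Both promises are handled at once: the hashing bound needs only weights at most `m N`, the
  -- trade-off only `m N ∈ W N`.
  have hWle : ∀ N, ∀ k ∈ W N, k ≤ m N := by
    rcases hW with h | h <;> intro N k hk <;> rw [h] at hk
    · exact hk
    · exact le_of_eq hk
  have hWmem : ∀ N, m N ∈ W N := by
    rcases hW with h | h <;> intro N <;> rw [h] <;> simp
  have hL := tendsto_logb_two_natCast
  have hl := tendsto_logb_two_logb_two_natCast
  have hlower : ∀ᶠ N : ℕ in atTop, ∀ P : OMAProtocol (StringsOfWeight (W N) N) (Fin N),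
      P.Solves (spIdx (W N) N) →
      Real.logb 2 (Real.logb 2 N) * Real.logb 2 N ≤
        100 * ((P.vcost + 1) * (P.hcost + Real.logb 2 N)) := by
    filter_upwards [hm, hL.eventually_ge_atTop 3, hl.eventually_ge_atTop 2,
      hL.eventually eventually_logb_two_add_one_sq_le,
      tendsto_natCast_atTop_atTop.eventually eventually_logb_two_add_one_sq_le]
      with N hmN h3 h2 hsq hsq' P hP
    rw [abs_lt] at hmN
    have hm2 : m N ^ 2 ≤ N := by
      have : (m N : ℝ) ^ 2 ≤ N := by
        calc (m N : ℝ) ^ 2 ≤ (Real.logb 2 (Real.logb 2 N) + 1) ^ 2 := by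
              gcongr; linarith
          _ ≤ Real.logb 2 N := hsq
          _ ≤ (Real.logb 2 N + 1) ^ 2 := by nlinarith
          _ ≤ N := hsq'
      exact_mod_cast this
    have h := hP.mul_logb_le (hWmem N) h3 hm2
    have : Real.logb 2 (Real.logb 2 N) * Real.logb 2 N ≤ (2 * m N) * Real.logb 2 N := by
      gcongr; linarith
    linarith
  have hupper : ∀ᶠ N : ℕ in atTop, ∃ P : OneWayProtocol (StringsOfWeight (W N) N) (Fin N),
      P.Solves (spIdx (W N) N) ∧ (P.cost : ℝ) ≤ 30 * Real.logb 2 (Real.logb 2 N) := by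
    filter_upwards [hm, hL.eventually_ge_atTop 1, hl.eventually_ge_atTop 10] with N hmN h1 h10
    exact exists_oneWayProtocol_spIdx_cost_le (hWle N) hmN h10 h1
  have hone : (fun N : ℕ => (oneWayComplexity (spIdx (W N) N) : ℝ)) =O[atTop]
      (fun N : ℕ => Real.logb 2 (Real.logb 2 (N : ℝ))) := by
    refine IsBigO.of_bound 30 ?_
    filter_upwards [hupper, hl.eventually_ge_atTop 0] with N ⟨P, hP, hc⟩ h0
    rw [Real.norm_of_nonneg (Nat.cast_nonneg _), Real.norm_of_nonneg h0]
    exact le_trans (by exact_mod_cast hP.complexity_le) hc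
  have hle : (fun N : ℕ => (omaComplexity (spIdx (W N) N) : ℝ)) =O[atTop]
      (fun N : ℕ => (oneWayComplexity (spIdx (W N) N) : ℝ)) := by
    refine IsBigO.of_bound 1 ?_
    filter_upwards [hupper] with N ⟨P, hP, _⟩
    rw [Real.norm_of_nonneg (Nat.cast_nonneg _), Real.norm_of_nonneg (Nat.cast_nonneg _), one_mul]
    exact_mod_cast hP.oma_le
  have hMA : (fun N : ℕ => Real.logb 2 (Real.logb 2 (N : ℝ))) =O[atTop]
      (fun N : ℕ => (omaComplexity (spIdx (W N) N) : ℝ)) := by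
    refine IsBigO.of_bound 400 ?_
    filter_upwards [hupper, hlower, hl.eventually_ge_atTop 400, hL.eventually_ge_atTop 1,
      hL.eventually eventually_logb_two_add_one_sq_le] with N ⟨P, hP, _⟩ hlow h400 h1 hsq
    obtain ⟨Q, hQ, hQc⟩ := hP.exists_oma
    have hQl := hlow Q hQ
    rw [Real.norm_of_nonneg (by linarith), Real.norm_of_nonneg (Nat.cast_nonneg _), ← hQc,
      OMAProtocol.tcost]
    push_cast
    have hv : (0 : ℝ) ≤ Q.vcost := Nat.cast_nonneg _
    have hh : (0 : ℝ) ≤ Q.hcost := Nat.cast_nonneg _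
    -- Either Merlin's message alone costs `log N`, or `200 * (vcost + 1) ≥ log log N`.
    rcases le_total (Real.logb 2 N) Q.hcost with hc | hc
    · nlinarith
    · have : Real.logb 2 (Real.logb 2 N) * Real.logb 2 N ≤
          (200 * (Q.vcost + 1)) * Real.logb 2 N := by
        nlinarith
      have := le_of_mul_le_mul_right this (by linarith)
      linarith
  refine ⟨⟨?_, ?_⟩, ⟨hone, hMA.trans hle⟩, ⟨hle.trans hone, hMA⟩⟩
  -- Merlin sends all `N` bits; non-triviality restricts only the verification cost.
  · refine ⟨fun N => fingerprintProtocol (spIdx (W N) N) fun x => List.ofFn x.1,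
      fun N => fingerprintProtocol_solves _ fun x x' h => Subtype.ext (List.ofFn_injective h), ?_⟩
    refine IsLittleO.trans_isBigO ?_ (hMA.trans hle)
    refine IsBigO.trans_isLittleO (g := fun _ => (1 : ℝ)) ?_ ?_
    · refine IsBigO.of_bound 2 (Eventually.of_forall fun N => ?_)
      rw [Real.norm_of_nonneg (Nat.cast_nonneg _), norm_one, mul_one]
      exact_mod_cast fingerprintProtocol_vcost_le _ _
    · exact (isLittleO_const_left_of_ne one_ne_zero).2 (tendsto_norm_atTop_atTop.comp hl)
  · rintro P ⟨hsol, hv⟩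
    have hv' := hv.trans_isBigO hone
    rw [isLittleO_iff]
    intro c hc
    -- Eventually `vcost + 1 ≤ 2 * δ * log log N`, so the trade-off gives `log N ≤ 200 * δ * (hcost
    -- + log N)`. As `200 * δ` is at most 1/2 and at most `c / 2`, the `log N` on the right is
    -- absorbed and `log N ≤ c * hcost` remains.
    set δ := min 1 c / 400 with hδ
    have hδ0 : 0 < δ := by positivity
    filter_upwards [hlower, hv'.bound hδ0, hl.eventually_ge_atTop (1 / δ),
      hl.eventually_ge_atTop 1, hL.eventually_ge_atTop 1] with N hlow hvN hbig h1 hL1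
    have h := hlow _ (hsol N)
    rw [Real.norm_of_nonneg (Nat.cast_nonneg _), Real.norm_of_nonneg (by linarith)] at hvN
    rw [Real.norm_of_nonneg (by linarith), Real.norm_of_nonneg (Nat.cast_nonneg _),
      OMAProtocol.tcost]
    push_cast
    rw [div_le_iff₀ hδ0] at hbig
    have hv0 : (0 : ℝ) ≤ (P N).vcost := Nat.cast_nonneg _
    have hh0 : (0 : ℝ) ≤ (P N).hcost := Nat.cast_nonneg _
    have h2 : Real.logb 2 (Real.logb 2 N) * Real.logb 2 N ≤
        Real.logb 2 (Real.logb 2 N) * (200 * δ * ((P N).hcost + Real.logb 2 N)) := by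
      calc _ ≤ _ := h
        _ ≤ 100 * ((2 * δ * Real.logb 2 (Real.logb 2 N)) *
              ((P N).hcost + Real.logb 2 N)) := by
            gcongr
            linarith
        _ = _ := by ring
    have h3 := le_of_mul_le_mul_left h2 (by linarith)
    have h4 : 200 * δ * (P N).hcost ≤ c / 2 * (P N).hcost := by
      gcongr
      have := min_le_right 1 c
      rw [hδ]; linarith
    have h5 : 200 * δ * Real.logb 2 N ≤ 1 / 2 * Real.logb 2 N := by
      gcongr
      have := min_le_left 1 c
      rw [hδ]; linarith
    nlinarith
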